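/- Let $n\ge 0$. A polyhedron in $\mathbb{R}^n$ is the solution set of a finite system of linear inequalities $Ax\le b$ with real coefficients; it is an integer polyhedron if it is the convex hull of its integer points, and a polyhedron $P$ is box-integer if $P\cap\{x\in\mathbb{R}^n \mid a\le x\le b\}$ is an integer polyhedron for all $a,b\in\mathbb{Z}^n$. A function $\Phi:\mathbb{Z}^n\to\mathbb{Z}\cup\{+\infty\}$ is integer-valued separable convex if $\Phi(x)=\sum_{i=1}^n\varphi_i(x_i)$ with functions $\varphi_i:\mathbb{Z}\to\mathbb{Z}\cup\{+\infty\}$ such that $\{k \mid \varphi_i(k)<+\infty\}$ is an interval of integers and $\varphi_i(k-1)+\varphi_i(k+1)\ge 2\varphi_i(k)$ for all $k\in\mathbb{Z}$. **Theorem.** Let $P\subseteq\mathbb{R}^n$ be a nonempty box-integer polyhedron and let $\Phi:\mathbb{Z}^n\to\mathbb{Z}\cup\{+\infty\}$ be an integer-valued separable convex function that is not identically $+\infty$. For $p\in\mathbb{Z}^n$ put $$\mu(p)=\min\{\langle p,x\rangle \mid x\in P\}\in\mathbb{R}\cup\{-\infty\},\qquad \Phi^{\bullet}(p)=\max\{\langle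 p,x\rangle-\Phi(x) \mid x\in\mathbb{Z}^n\}\in\mathbb{R}\cup\{+\infty\},$$ where $\min$ and $\max$ are read as infimum and supremum; they are attained whenever they are finite. If the infimum of $\Phi$ over $P\cap\mathbb{Z}^n$ is finite, or the supremum of $\mu(p)-\Phi^{\bullet}(p)$ over $p\in\mathbb{Z}^n$ is finite (a difference with $\mu(p)=-\infty$ or $\Phi^{\bullet}(p)=+\infty$ being $-\infty$, and the infimum over the empty set being $+\infty$), then both are attained, and their common value is an integer: $$\min\{\Phi(x) \mid x\in P\cap\mathbb{Z}^n\}=\max\{\mu(p)-\Phi^{\bullet}(p) \mid p\in\mathbb{Z}^n\}\in\mathbb{Z}.$$ -/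

import Mathlib

open Set

/-- A polyhedron in `ℝⁿ`: the solution set of a finite system of (non-strict) linear inequalities
`A x ≤ b` with real data. -/
def IsPolyhedron {n : ℕ} (P : Set (Fin n → ℝ)) : Prop :=
  ∃ (m : ℕ) (A : Matrix (Fin m) (Fin n) ℝ) (b : Fin m → ℝ), P = {x | ∀ j, (A.mulVec x) j ≤ b j}

/-- The inclusion `ℤⁿ → ℝⁿ`. -/
def intVec {n : ℕ} (x : Fin n → ℤ) : Fin n → ℝ := fun i => (x i : ℝ)

/-- `P ∩ ℤⁿ`, as a set of integer vectors. -/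
def integerPoints {n : ℕ} (P : Set (Fin n → ℝ)) : Set (Fin n → ℤ) := {x | intVec x ∈ P}

/-- An integer polyhedron: a polyhedron that is the convex hull of its integer points. -/
def IsIntegerPolyhedron {n : ℕ} (P : Set (Fin n → ℝ)) : Prop :=
  IsPolyhedron P ∧ convexHull ℝ (intVec '' integerPoints P) = P

/-- A box-integer polyhedron: a polyhedron whose intersection with every box
`{x | a ≤ x ≤ b}`, `a` and `b` integer vectors, is an integer polyhedron. -/
def IsBoxInteger {n : ℕ} (P : Set (Fin n → ℝ)) : Prop :=
  IsPolyhedron P ∧ ∀ a b : Fin n → ℤ, IsIntegerPolyhedron (P ∩ Icc (intVec a) (intVec b))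

/-- The effective domain of a function with values in `ℤ ∪ {+∞}`. -/
def effDom {α : Type*} (f : α → WithTop ℤ) : Set α := {x | f x ≠ ⊤}

/-- A univariate discrete convex function `φ : ℤ → ℤ ∪ {+∞}`: its effective domain is an interval
of integers and `φ (k - 1) + φ (k + 1) ≥ 2 φ k` for all integers `k`. -/
def IsDiscreteConvex (φ : ℤ → WithTop ℤ) : Prop :=
  (effDom φ).OrdConnected ∧ ∀ k : ℤ, φ k + φ k ≤ φ (k - 1) + φ (k + 1)

/-- An integer-valued separable convex function `Φ : ℤⁿ → ℤ ∪ {+∞}`. -/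
def IsSeparableConvex {n : ℕ} (Φ : (Fin n → ℤ) → WithTop ℤ) : Prop :=
  ∃ φ : Fin n → ℤ → WithTop ℤ, (∀ i, IsDiscreteConvex (φ i)) ∧ ∀ x, Φ x = ∑ i, φ i (x i)

/-- The inclusion `ℤ ∪ {+∞} → [-∞, +∞]`. -/
noncomputable def toExtendedReal : WithTop ℤ → EReal
  | ⊤ => ⊤
  | (k : ℤ) => ((k : ℝ) : EReal)

/-- The inner product `⟨p, x⟩ = ∑ i, p i * x i` of `p ∈ ℤⁿ` and `x ∈ ℝⁿ`. -/
def pairing {n : ℕ} (p : Fin n → ℤ) (x : Fin n → ℝ) : ℝ := ∑ i, (p i : ℝ) * x i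

/-- The integral conjugate `Φ•(p) = sup {⟨p, x⟩ - Φ(x) | x ∈ ℤⁿ}`, for `p ∈ ℤⁿ`, as an extended
real number. -/
noncomputable def integralConjugate {n : ℕ} (Φ : (Fin n → ℤ) → WithTop ℤ) (p : Fin n → ℤ) :
    EReal :=
  ⨆ x : Fin n → ℤ, ((pairing p (intVec x) : ℝ) : EReal) - toExtendedReal (Φ x)

/-- `μ(p) = inf {⟨p, x⟩ | x ∈ P}`, for `p ∈ ℤⁿ`, as an extended real number. -/
noncomputable def mu {n : ℕ} (P : Set (Fin n → ℝ)) (p : Fin n → ℤ) : EReal :=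
  ⨅ x ∈ P, ((pairing p x : ℝ) : EReal)

/-- An extended real number is finite. -/
def IsFiniteValue (a : EReal) : Prop := a ≠ ⊥ ∧ a ≠ ⊤

/-! Weak duality is immediate. For strong duality, let `x` minimize `Φ` over the integer points of
`P`. An integral `p` is needed that is a subgradient of `Φ` at `x` and is minimized over `P` at `x`;
such a `p` attains the minimum of `Φ` as dual value.

By discrete convexity, `p` is a subgradient as soon as each `p i` lies between the left slope `l i`
and the right slope `u i` of `φ i` at `x i`. Minimality of `x` says that the sum of the `kink (l i)
(u i)` is nonnegative on the `{-1, 0, 1}`-directions into `P`. `IsBoxInteger.exists_update` shrinks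
one interval `[l j, u j]` to an integer while keeping this inequality, as in a Hahn–Banach
extension. Once all intervals are points, the inequality is linear and extends to all of `P`
(`IsBoxInteger.exists_integral_dual`).

If only the dual is known to be finite, feasibility of the primal must be shown. Otherwise the
subgradient result, applied to the `ℓ₁`-distance from the domain of `Φ`, yields an integral
functional separating `P` from the domain, along which the dual value is unbounded. -/

/-! ### Kinked linear functions on box-integer polyhedra -/

/-- The function on `R` with slope `l` on the negative and `u` on the nonnegative elements. -/
def kink {R : Type*} [Ring R] [LinearOrder R] (l u t : R) : R := l * t + (u - l) * max t 0

lemma kink_of_nonneg {R : Type*} [Ring R] [LinearOrder R] (l u : R) {t : R} (ht : 0 ≤ t) :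
    kink l u t = u * t := by
  rw [kink, max_eq_left ht, sub_mul, add_sub_cancel]

lemma kink_of_nonpos {R : Type*} [Ring R] [LinearOrder R] (l u : R) {t : R} (ht : t ≤ 0) :
    kink l u t = l * t := by
  rw [kink, max_eq_right ht, mul_zero, add_zero]

lemma kink_self {R : Type*} [Ring R] [LinearOrder R] (p t : R) : kink p p t = p * t := by
  simp [kink]

lemma kink_intCast (l u t : ℤ) : kink (l : ℝ) u t = (kink l u t : ℤ) := by
  simp [kink]

lemma kink_half_add_le {l u : ℝ} (h : l ≤ u) (s t : ℝ) :
    2 * kink l u ((s + t) / 2) ≤ kink l u s + kink l u t := by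
  have hmax : 2 * max ((s + t) / 2) 0 ≤ max s 0 + max t 0 := by
    have h1 := le_max_left s 0
    have h2 := le_max_left t 0
    have h3 := le_max_right s 0
    have h4 := le_max_right t 0
    rcases max_cases ((s + t) / 2) 0 with ⟨h, -⟩ | ⟨h, -⟩ <;> rw [h] <;> linarith
  have := mul_le_mul_of_nonneg_left hmax (sub_nonneg.2 h)
  unfold kink
  linarith

lemma IsPolyhedron.convex {n : ℕ} {P : Set (Fin n → ℝ)} (hP : IsPolyhedron P) : Convex ℝ P := by
  obtain ⟨m, A, b, rfl⟩ := hP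
  rw [ofPred_forall]
  exact convex_iInter fun j => convex_halfSpace_le
    ⟨fun x y => by simp [Matrix.mulVec_add], fun c x => by simp [Matrix.mulVec_smul]⟩ (b j)

/-- Affine lower bounds at the integer points of a cube containing `y` carry over to `y`. -/
lemma IsBoxInteger.sum_mul_nonneg {n : ℕ} {P : Set (Fin n → ℝ)} (hP : IsBoxInteger P)
    (c y : Fin n → ℝ) (hy : y ∈ P) (r : ℝ) (a b : Fin n → ℤ) (hab : y ∈ Icc (intVec a) (intVec b))
    (h : ∀ z ∈ integerPoints P, z ∈ Icc a b → r ≤ ∑ i, c i * (z i : ℝ)) :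
    r ≤ ∑ i, c i * y i := by
  have hy' : y ∈ P ∩ Icc (intVec a) (intVec b) := ⟨hy, hab⟩
  rw [← (hP.2 a b).2] at hy'
  have hconv : Convex ℝ {w : Fin n → ℝ | r ≤ ∑ i, c i * w i} :=
    convex_halfSpace_ge
      ⟨fun x y => by simp [mul_add, Finset.sum_add_distrib],
        fun t x => by simp [Finset.mul_sum, mul_left_comm]⟩ r
  refine convexHull_min ?_ hconv hy'
  rintro _ ⟨z, ⟨hz, hz1, hz2⟩, rfl⟩
  exact h z hz ⟨fun i => Int.cast_le.1 (hz1 i), fun i => Int.cast_le.1 (hz2 i)⟩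

/-- The box between the coordinatewise roundings of `m` crosses no kink: each `[⌊m i⌋, ⌈m i⌉]` lies
on one side of `0`. The sum is therefore linear there, and its sign passes from the integer points
of `P` in the shifted box to `x + m`. -/
lemma IsBoxInteger.sum_kink_nonneg {n : ℕ} {P : Set (Fin n → ℝ)} (hP : IsBoxInteger P)
    (x l u : Fin n → ℤ) (m : Fin n → ℝ) (hm : intVec x + m ∈ P)
    (h : ∀ e : Fin n → ℤ, x + e ∈ integerPoints P → (∀ i, ⌊m i⌋ ≤ e i ∧ e i ≤ ⌈m i⌉) →
      0 ≤ ∑ i, kink (l i) (u i) (e i)) :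
    0 ≤ ∑ i, kink (l i : ℝ) (u i) (m i) := by
  set c : Fin n → ℝ := fun i => if 0 ≤ m i then (u i : ℝ) else l i with hc
  have key := hP.sum_mul_nonneg c _ hm (∑ i, c i * x i) (fun i => x i + ⌊m i⌋)
    (fun i => x i + ⌈m i⌉)
    ⟨fun i => by simpa [intVec] using Int.floor_le (m i),
      fun i => by simpa [intVec] using Int.le_ceil (m i)⟩ ?_
  · have : ∑ i, c i * (intVec x + m) i = ∑ i, c i * x i + ∑ i, kink (l i : ℝ) (u i) (m i) := by
      rw [← Finset.sum_add_distrib]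
      refine Finset.sum_congr rfl fun i _ => ?_
      simp only [Pi.add_apply, intVec, mul_add, hc]
      split_ifs with h0
      · rw [kink_of_nonneg _ _ h0]
      · rw [kink_of_nonpos _ _ (not_le.1 h0).le]
    linarith
  · intro z hz hz'
    have hle := h (z - x) (by simpa using hz) fun i => by
      have h1 := hz'.1 i
      have h2 := hz'.2 i
      simp only [Pi.sub_apply] at *
      omega
    have : ∑ i, c i * (z i : ℝ) =
        ∑ i, c i * x i + ((∑ i, kink (l i) (u i) ((z - x) i) : ℤ) : ℝ) := by
      rw [Int.cast_sum, ← Finset.sum_add_distrib]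
      refine Finset.sum_congr rfl fun i _ => ?_
      have h1 := hz'.1 i
      have h2 := hz'.2 i
      simp only [Pi.sub_apply, hc] at *
      split_ifs with h0
      · have := Int.floor_nonneg.2 h0
        rw [kink_of_nonneg _ _ (by omega)]
        push_cast
        ring
      · have : ⌈m i⌉ ≤ 0 := Int.ceil_le.2 (by simpa using (not_le.1 h0).le)
        rw [kink_of_nonpos _ _ (by omega)]
        push_cast
        ring
    have hr : (0 : ℝ) ≤ ((∑ i, kink (l i) (u i) ((z - x) i) : ℤ) : ℝ) := by exact_mod_cast hle
    linarith

/-! ### Integral dual vectors, one coordinate at a time -/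

/-- The integral directions with entries in `{-1, 0, 1}` that lead from `x` to points of `P`. -/
def unitDirections {n : ℕ} (P : Set (Fin n → ℝ)) (x : Fin n → ℤ) : Set (Fin n → ℤ) :=
  {e | x + e ∈ integerPoints P ∧ ∀ i, -1 ≤ e i ∧ e i ≤ 1}

/-- Directions with `e j = 1` bound `p` below by `-r e`, those with `e j = -1` bound it above by `r
e`. The bounds are compatible because the midpoint of two such directions has `j`-th entry `0`,
where the kink vanishes, and `kink` is midpoint convex when `l ≤ u`. -/
lemma IsBoxInteger.exists_update {n : ℕ} {P : Set (Fin n → ℝ)} (hP : IsBoxInteger P)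
    (x l u : Fin n → ℤ) (hlu : l ≤ u)
    (h : ∀ e ∈ unitDirections P x, 0 ≤ ∑ i, kink (l i) (u i) (e i)) (j : Fin n) :
    ∃ p, l j ≤ p ∧ p ≤ u j ∧ ∀ e ∈ unitDirections P x,
      0 ≤ ∑ i, kink (Function.update l j p i) (Function.update u j p i) (e i) := by
  set r : (Fin n → ℤ) → ℤ := fun e => ∑ i ∈ Finset.univ.erase j, kink (l i) (u i) (e i) with hr
  have hsplit (e : Fin n → ℤ) :
      ∑ i, kink (l i) (u i) (e i) = kink (l j) (u j) (e j) + r e :=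
    (Finset.add_sum_erase _ _ (Finset.mem_univ j)).symm
  have hpos {e} (he : e ∈ unitDirections P x) (hj : e j = 1) : 0 ≤ u j + r e := by
    have := h e he
    rwa [hsplit, hj, kink_of_nonneg _ _ zero_le_one, mul_one] at this
  have hneg {e} (he : e ∈ unitDirections P x) (hj : e j = -1) : 0 ≤ -l j + r e := by
    have := h e he
    rwa [hsplit, hj, kink_of_nonpos _ _ (by norm_num), mul_neg_one] at this
  have hcompat {d e} (hd : d ∈ unitDirections P x) (hdj : d j = 1)
      (he : e ∈ unitDirections P x) (hej : e j = -1) : 0 ≤ r d + r e := by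
    set m : Fin n → ℝ := fun i => ((d i : ℝ) + e i) / 2 with hm
    have hmem : intVec x + m ∈ P := by
      have := hP.1.convex hd.1 he.1 (a := 1 / 2) (b := 1 / 2) (by norm_num) (by norm_num)
        (by norm_num)
      convert this using 1
      ext i
      simp [intVec, hm]
      ring
    -- The midpoint need not be integral, but its entries lie in `[-1, 1]`, so every integral
    -- rounding of it that leads into `P` is again a unit direction.
    have h0 := hP.sum_kink_nonneg x l u m hmem fun f hf hfm => h f ⟨hf, fun i => by
      have hd' := hd.2 i
      have he' := he.2 i
      have h1 : (-1 : ℤ) ≤ ⌊m i⌋ := Int.le_floor.2 (by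
        have h1 : (-1 : ℝ) ≤ d i := by exact_mod_cast hd'.1
        have h2 : (-1 : ℝ) ≤ e i := by exact_mod_cast he'.1
        simp only [hm]
        push_cast
        linarith)
      have h2 : ⌈m i⌉ ≤ (1 : ℤ) := Int.ceil_le.2 (by
        have h1 : (d i : ℝ) ≤ 1 := by exact_mod_cast hd'.2
        have h2 : (e i : ℝ) ≤ 1 := by exact_mod_cast he'.2
        simp only [hm]
        push_cast
        linarith)
      exact ⟨h1.trans (hfm i).1, (hfm i).2.trans h2⟩⟩
    rw [← Finset.add_sum_erase _ _ (Finset.mem_univ j)] at h0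
    have hmj : kink (l j : ℝ) (u j) (m j) = 0 := by simp [kink, hm, hdj, hej]
    have hle : 2 * ∑ i ∈ Finset.univ.erase j, kink (l i : ℝ) (u i) (m i) ≤ (r d + r e : ℤ) := by
      rw [Finset.mul_sum, hr]
      push_cast [← kink_intCast]
      rw [← Finset.sum_add_distrib]
      exact Finset.sum_le_sum fun i _ => kink_half_add_le (by exact_mod_cast hlu i) _ _
    have : (0 : ℝ) ≤ (r d + r e : ℤ) := by linarith
    exact_mod_cast this
  -- The greatest of the lower bounds; it is an integer because all of them are.
  obtain ⟨p, hp, hpmax⟩ := Int.exists_greatest_of_bdd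
    (P := fun k => k = l j ∨ ∃ e ∈ unitDirections P x, e j = 1 ∧ k = -r e)
    ⟨u j, by
      rintro k (rfl | ⟨e, he, hej, rfl⟩)
      · exact hlu j
      · linarith [hpos he hej]⟩ ⟨l j, Or.inl rfl⟩
  refine ⟨p, hpmax _ (Or.inl rfl), ?_, fun e he => ?_⟩
  · rcases hp with rfl | ⟨e, he, hej, rfl⟩
    · exact hlu j
    · linarith [hpos he hej]
  · have hupd : ∑ i, kink (Function.update l j p i) (Function.update u j p i) (e i)
        = p * e j + r e := by
      rw [← Finset.add_sum_erase _ _ (Finset.mem_univ j), Function.update_self,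
        Function.update_self, kink_self]
      congr 1
      refine Finset.sum_congr rfl fun i hi => ?_
      rw [Function.update_of_ne (Finset.ne_of_mem_erase hi),
        Function.update_of_ne (Finset.ne_of_mem_erase hi)]
    rw [hupd]
    obtain h1 | h1 | h1 : e j = -1 ∨ e j = 0 ∨ e j = 1 := by
      have := he.2 j
      omega
    · rw [h1]
      rcases hp with rfl | ⟨d, hd, hdj, rfl⟩
      · linarith [hneg he h1]
      · linarith [hcompat hd hdj he h1]
    · have := h e he
      rw [hsplit, h1] at this
      simpa [kink, h1] using this
    · rw [h1]
      linarith [hpmax _ (Or.inr ⟨e, he, h1, rfl⟩)]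

/-- Box integrality of the dual of the cone of directions of a box-integer polyhedron. -/
lemma IsBoxInteger.exists_integral_dual {n : ℕ} {P : Set (Fin n → ℝ)} (hP : IsBoxInteger P)
    (x l u : Fin n → ℤ) (hx : x ∈ integerPoints P) (hlu : l ≤ u)
    (h : ∀ e ∈ unitDirections P x, 0 ≤ ∑ i, kink (l i) (u i) (e i)) :
    ∃ p, l ≤ p ∧ p ≤ u ∧ ∀ y ∈ P, pairing p (intVec x) ≤ pairing p y := by
  have hfix (s : Finset (Fin n)) : ∃ l' u' : Fin n → ℤ, l ≤ l' ∧ l' ≤ u' ∧ u' ≤ u ∧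
      (∀ i ∈ s, l' i = u' i) ∧
      ∀ e ∈ unitDirections P x, 0 ≤ ∑ i, kink (l' i) (u' i) (e i) := by
    induction s using Finset.induction_on with
    | empty => exact ⟨l, u, le_rfl, hlu, le_rfl, by simp, h⟩
    | insert j s _ ih =>
      obtain ⟨l', u', hl, hlu', hu, heq, h'⟩ := ih
      obtain ⟨p, hlp, hpu, hp⟩ := hP.exists_update x l' u' hlu' h' j
      refine ⟨Function.update l' j p, Function.update u' j p,
        hl.trans (le_update_self_iff.2 hlp), update_le_update_iff.2
          ⟨le_rfl, fun i _ => hlu' i⟩, (update_le_self_iff.2 hpu).trans hu, ?_, hp⟩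
      intro i hi
      by_cases hij : i = j
      · subst hij
        simp
      · simp [hij, heq i ((Finset.mem_insert.1 hi).resolve_left hij)]
  obtain ⟨p, p', hl, -, hu, heq, hp⟩ := hfix Finset.univ
  obtain rfl : p = p' := funext fun i => heq i (Finset.mem_univ i)
  refine ⟨p, hl, hu, fun y hy => ?_⟩
  simp only [kink_self] at hp
  -- Dividing `y - x` by `B` brings it into the unit cube; since `B ≥ 1`, the scaled point stays on
  -- the segment from `x` to `y`.
  set B : ℝ := 1 + ∑ i, |y i - x i| with hB
  have hB0 : 0 < B := by positivity
  have hB1 : 1 ≤ B := by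
    rw [hB]
    have : 0 ≤ ∑ i, |y i - x i| := by positivity
    linarith
  have hbound (i) : |(y i - x i) / B| ≤ 1 := by
    rw [abs_div, abs_of_pos hB0, div_le_one hB0]
    have := Finset.single_le_sum (f := fun i => |y i - x i|) (fun i _ => abs_nonneg _)
      (Finset.mem_univ i)
    linarith
  have hmem : intVec x + (fun i => (y i - x i) / B) ∈ P := by
    have := hP.1.convex hx hy (a := 1 - 1 / B) (b := 1 / B)
      (sub_nonneg.2 ((div_le_one hB0).2 hB1)) (by positivity) (by ring)
    convert this using 1
    ext i
    simp [intVec]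
    field_simp
    ring
  have h0 := hP.sum_kink_nonneg x p p _ hmem fun e he hem => by
    simp only [kink_self]
    refine hp e ⟨he, fun i => ?_⟩
    have hb := abs_le.1 (hbound i)
    exact ⟨le_trans (Int.le_floor.2 (by simpa using hb.1)) (hem i).1,
      (hem i).2.trans (Int.ceil_le.2 (by simpa using hb.2))⟩
  simp only [kink_self, ← mul_div_assoc, ← Finset.sum_div] at h0
  have h1 := (div_nonneg_iff.1 h0).resolve_right (fun h => absurd h.2 (not_le.2 hB0))
  simpa [pairing, intVec, mul_sub, Finset.sum_sub_distrib] using h1.1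

/-! ### Univariate discrete convexity: local slopes bound globally -/

namespace IsDiscreteConvex

variable {φ : ℤ → WithTop ℤ}

lemma comp_neg (hφ : IsDiscreteConvex φ) : IsDiscreteConvex fun t => φ (-t) := by
  refine ⟨⟨fun a ha b hb c hc => ?_⟩, fun k => ?_⟩
  · exact hφ.1.out hb ha ⟨neg_le_neg hc.2, neg_le_neg hc.1⟩
  · have := hφ.2 (-k)
    rw [add_comm (φ (-k - 1))] at this
    convert this using 3 <;> ring

/-- Increments are nondecreasing, so all are at least `p`. A finite value further right makes the
values in between finite, since the domain is an interval; at infinite values there is nothing to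
prove. -/
lemma le_of_le_succ (hφ : IsDiscreteConvex φ) {x v p : ℤ} (hx : φ x = v)
    (h : ((v + p : ℤ) : WithTop ℤ) ≤ φ (x + 1)) (k : ℕ) :
    ((v + p * k : ℤ) : WithTop ℤ) ≤ φ (x + k) := by
  have key : ∀ k : ℕ, ∀ b : ℤ, φ (x + k + 1) = b →
      ∃ a : ℤ, φ (x + k) = a ∧ a + p ≤ b ∧ v + p * k ≤ a := by
    intro k
    induction k with
    | zero =>
      intro b hb
      refine ⟨v, by simpa using hx, ?_, by simp⟩
      rw [← WithTop.coe_le_coe, ← hb]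
      simpa using h
    | succ k ih =>
      intro b hb
      have hfin : φ (x + k + 1) ≠ ⊤ :=
        hφ.1.out (show φ x ≠ ⊤ by simp [hx]) (show φ (x + (k + 1 : ℕ) + 1) ≠ ⊤ by rw [hb]; exact WithTop.coe_ne_top)
          ⟨by omega, by push_cast; omega⟩
      obtain ⟨a, ha⟩ := WithTop.ne_top_iff_exists.1 hfin
      obtain ⟨c, hc, hca, hvc⟩ := ih a ha.symm
      have hconv := hφ.2 (x + k + 1)
      rw [add_sub_cancel_right, hc, ← ha, show x + k + 1 + 1 = x + (k + 1 : ℕ) + 1 by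
        push_cast; ring, hb] at hconv
      norm_cast at hconv
      refine ⟨a, by rw [ha]; push_cast; ring_nf, by linarith, ?_⟩
      push_cast
      linarith
  obtain _ | k := k
  · simp [hx]
  · by_cases hfin : φ (x + (k + 1 : ℕ)) = ⊤
    · rw [hfin]
      exact le_top
    · obtain ⟨b, hb⟩ := WithTop.ne_top_iff_exists.1 hfin
      obtain ⟨a, -, hab, hva⟩ := key k b (by rw [hb]; push_cast; ring_nf)
      rw [← hb, WithTop.coe_le_coe]
      push_cast
      linarith

lemma le_of_le_neighbours (hφ : IsDiscreteConvex φ) {x v p : ℤ} (hx : φ x = v)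
    (h₁ : ((v + p : ℤ) : WithTop ℤ) ≤ φ (x + 1)) (h₂ : ((v - p : ℤ) : WithTop ℤ) ≤ φ (x - 1))
    (t : ℤ) : ((v + p * (t - x) : ℤ) : WithTop ℤ) ≤ φ t := by
  obtain ht | ht := le_total x t
  · obtain ⟨k, rfl⟩ := Int.le.dest ht
    simpa using hφ.le_of_le_succ hx h₁ k
  · obtain ⟨k, rfl⟩ := Int.le.dest ht
    have := hφ.comp_neg.le_of_le_succ (x := -(t + k)) (v := v) (p := -p) (by simpa using hx)
      (by convert h₂ using 2 <;> ring) k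
    convert this using 2 <;> ring

end IsDiscreteConvex

/-! ### Integral subgradients at a minimizer -/

lemma coe_sub_untopD (a : WithTop ℤ) (h : a ≠ ⊤) (v w : ℤ) :
    ((v + (a.untopD w - v) : ℤ) : WithTop ℤ) = a := by
  obtain ⟨k, rfl⟩ := WithTop.ne_top_iff_exists.1 h
  simp

/-- A minimizer of an integer-valued separable convex function over the integer points of a
box-integer polyhedron admits an integral subgradient that is minimized over the polyhedron at
this point. -/
lemma IsBoxInteger.exists_integral_subgradient {n : ℕ} {P : Set (Fin n → ℝ)}
    (hP : IsBoxInteger P) (φ : Fin n → ℤ → WithTop ℤ) (hφ : ∀ i, IsDiscreteConvex (φ i))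
    (x v : Fin n → ℤ) (hx : x ∈ integerPoints P) (hv : ∀ i, φ i (x i) = v i)
    (hmin : ∀ y ∈ integerPoints P, ((∑ i, v i : ℤ) : WithTop ℤ) ≤ ∑ i, φ i (y i)) :
    ∃ p : Fin n → ℤ, (∀ y ∈ P, pairing p (intVec x) ≤ pairing p y) ∧
      ∀ i t, ((v i + p i * (t - x i) : ℤ) : WithTop ℤ) ≤ φ i t := by
  -- Right and left slopes at `x i`; the default `v i` makes an infinite slope `0` here.
  set a : Fin n → ℤ := fun i => (φ i (x i + 1)).untopD (v i) - v i with ha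
  set b : Fin n → ℤ := fun i => v i - (φ i (x i - 1)).untopD (v i) with hb
  -- The finite stand-in for an infinite slope, large enough to outweigh all other terms in a sum
  -- over a unit direction.
  set M : ℤ := ∑ i, (|a i| + |b i|) with hM
  have hMi (i) : |a i| + |b i| ≤ M :=
    Finset.single_le_sum (f := fun i => |a i| + |b i|) (fun i _ => by positivity)
      (Finset.mem_univ i)
  set u : Fin n → ℤ := fun i => if φ i (x i + 1) = ⊤ then M else a i with hu
  set l : Fin n → ℤ := fun i => if φ i (x i - 1) = ⊤ then -M else b i with hl
  have hupos (i) : ((v i + a i : ℤ) : WithTop ℤ) = φ i (x i + 1) ∨ φ i (x i + 1) = ⊤ :=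
    or_iff_not_imp_right.2 fun h => coe_sub_untopD _ h _ _
  have hlpos (i) : ((v i - b i : ℤ) : WithTop ℤ) = φ i (x i - 1) ∨ φ i (x i - 1) = ⊤ :=
    or_iff_not_imp_right.2 fun h => by
      rw [← coe_sub_untopD _ h (v i) (v i), hb]
      congr 1
      ring
  have hlu : l ≤ u := by
    intro i
    have h1 := hMi i
    have h2 := le_abs_self (b i)
    have h3 := neg_abs_le (a i)
    have h4 := abs_nonneg (a i)
    have h5 := abs_nonneg (b i)
    simp only [hu, hl]
    split_ifs with hd hc hc
    · linarith
    · linarith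
    · linarith
    · have h := (hφ i).2 (x i)
      rw [hv, ← (hupos i).resolve_right hc, ← (hlpos i).resolve_right hd] at h
      norm_cast at h
      linarith
  have hterm (i) (t : ℤ) (ht : -1 ≤ t ∧ t ≤ 1) :
      ((v i + kink (l i) (u i) t : ℤ) : WithTop ℤ) = φ i (x i + t) ∨
        φ i (x i + t) = ⊤ ∧ kink (l i) (u i) t = M := by
    obtain rfl | rfl | rfl : t = -1 ∨ t = 0 ∨ t = 1 := by omega
    · rw [kink_of_nonpos _ _ (by norm_num), ← sub_eq_add_neg]
      by_cases hd : φ i (x i - 1) = ⊤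
      · exact Or.inr ⟨hd, by simp [hl, hd]⟩
      · left
        simpa [hl, hd, ← sub_eq_add_neg] using (hlpos i).resolve_right hd
    · left
      simp [kink, hv]
    · rw [kink_of_nonneg _ _ (by norm_num)]
      by_cases hc : φ i (x i + 1) = ⊤
      · exact Or.inr ⟨hc, by simp [hu, hc]⟩
      · left
        simpa [hu, hc] using (hupos i).resolve_right hc
  have hlower (i) (t : ℤ) (ht : -1 ≤ t ∧ t ≤ 1) : -(|a i| + |b i|) ≤ kink (l i) (u i) t := by
    have h1 := hMi i
    have h2 := le_abs_self (b i)
    have h3 := neg_abs_le (a i)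
    have h4 := abs_nonneg (a i)
    have h5 := abs_nonneg (b i)
    obtain rfl | rfl | rfl : t = -1 ∨ t = 0 ∨ t = 1 := by omega
    · rw [kink_of_nonpos _ _ (by norm_num)]
      simp only [hl]
      split_ifs <;> linarith
    · simp only [kink, max_self, mul_zero, add_zero]
      linarith
    · rw [kink_of_nonneg _ _ (by norm_num)]
      simp only [hu]
      split_ifs <;> linarith
  obtain ⟨p, hlp, hpu, hp⟩ := hP.exists_integral_dual x l u hx hlu fun e he => by
    by_cases htop : ∃ i, φ i (x i + e i) = ⊤ ∧ kink (l i) (u i) (e i) = M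
    -- One term equals `M`, and the others are at least `-(|a i| + |b i|)`, so the sum is
    -- nonnegative without using minimality.
    · obtain ⟨j, -, hj⟩ := htop
      have h1 : ∑ i ∈ Finset.univ.erase j, -(|a i| + |b i|) ≤
          ∑ i ∈ Finset.univ.erase j, kink (l i) (u i) (e i) :=
        Finset.sum_le_sum fun i _ => hlower i _ (he.2 i)
      have h2 := Finset.add_sum_erase Finset.univ (fun i => |a i| + |b i|) (Finset.mem_univ j)
      have h3 : 0 ≤ |a j| + |b j| := by positivity
      rw [← Finset.add_sum_erase _ _ (Finset.mem_univ j), hj]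
      rw [Finset.sum_neg_distrib] at h1
      linarith
    · have hsum : ∑ i, φ i ((x + e) i) = ((∑ i, (v i + kink (l i) (u i) (e i)) : ℤ)) := by
        rw [WithTop.coe_sum]
        exact Finset.sum_congr rfl fun i _ =>
          ((hterm i _ (he.2 i)).resolve_right fun h => htop ⟨i, h⟩).symm
      have := hmin _ he.1
      rw [hsum, WithTop.coe_le_coe, Finset.sum_add_distrib] at this
      linarith
  refine ⟨p, hp, fun i t => (hφ i).le_of_le_neighbours (hv i) ?_ ?_ t⟩
  · obtain h | h := hupos i
    · have hpi := hpu i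
      simp only [hu, ← h, WithTop.coe_ne_top, if_false] at hpi
      rw [← h, WithTop.coe_le_coe]
      linarith
    · simp [h]
  · obtain h | h := hlpos i
    · have hpi := hlp i
      simp only [hl, ← h, WithTop.coe_ne_top, if_false] at hpi
      rw [← h, WithTop.coe_le_coe]
      linarith
    · simp [h]

/-- Here `s = ⟨p, x⟩`, so one constant serves both the bound on `P` and the affine minorant of `Φ`.
-/
lemma IsSeparableConvex.exists_integral_subgradient {n : ℕ} {P : Set (Fin n → ℝ)}
    (hP : IsBoxInteger P) {Φ : (Fin n → ℤ) → WithTop ℤ} (hΦ : IsSeparableConvex Φ)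
    {x : Fin n → ℤ} {m : ℤ} (hx : x ∈ integerPoints P) (hm : Φ x = m)
    (hmin : ∀ y ∈ integerPoints P, (m : WithTop ℤ) ≤ Φ y) :
    ∃ (p : Fin n → ℤ) (s : ℤ), (∀ y ∈ P, (s : ℝ) ≤ pairing p y) ∧
      ∀ z, ((m - s + ∑ i, p i * z i : ℤ) : WithTop ℤ) ≤ Φ z := by
  obtain ⟨φ, hφ, hΦφ⟩ := hΦ
  have hfin (i) : φ i (x i) ≠ ⊤ := by
    have : ∑ i, φ i (x i) ≠ ⊤ := by simp [← hΦφ, hm]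
    exact fun h => this (WithTop.sum_eq_top.2 ⟨i, Finset.mem_univ i, h⟩)
  choose v hv using fun i => WithTop.ne_top_iff_exists.1 (hfin i)
  have hmv : m = ∑ i, v i := by
    rw [hΦφ, ← Finset.sum_congr rfl fun i _ => hv i, ← WithTop.coe_sum] at hm
    exact_mod_cast hm.symm
  obtain ⟨p, hp, hpφ⟩ := hP.exists_integral_subgradient φ hφ x v hx (fun i => (hv i).symm)
    fun y hy => by rw [← hmv, ← hΦφ]; exact hmin y hy
  have hs : pairing p (intVec x) = (∑ i, p i * x i : ℤ) := by simp [pairing, intVec]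
  refine ⟨p, ∑ i, p i * x i, fun y hy => hs ▸ hp y hy, fun z => ?_⟩
  rw [hΦφ, hmv, ← Finset.sum_sub_distrib, ← Finset.sum_add_distrib, WithTop.coe_sum]
  refine Finset.sum_le_sum fun i _ => le_trans (le_of_eq ?_) (hpφ i (z i))
  congr 1
  ring

/-! ### Attainment for integer values, and distances to intervals -/

lemma exists_minimizer {α : Type*} {S : Set α} {Φ : α → WithTop ℤ} (hne : ∃ x ∈ S, Φ x ≠ ⊤)
    {B : ℤ} (hB : ∀ x ∈ S, (B : WithTop ℤ) ≤ Φ x) :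
    ∃ x ∈ S, ∃ m : ℤ, Φ x = m ∧ ∀ y ∈ S, (m : WithTop ℤ) ≤ Φ y := by
  obtain ⟨m, ⟨x, hx, hxm⟩, hm⟩ := Int.exists_least_of_bdd (P := fun k : ℤ => ∃ x ∈ S, Φ x = k)
    ⟨B, by
      rintro k ⟨x, hx, hk⟩
      exact WithTop.coe_le_coe.1 (hk ▸ hB x hx)⟩
    (by
      obtain ⟨x, hx, h⟩ := hne
      obtain ⟨k, hk⟩ := WithTop.ne_top_iff_exists.1 h
      exact ⟨k, x, hx, hk.symm⟩)
  refine ⟨x, hx, m, hxm, fun y hy => ?_⟩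
  by_cases h : Φ y = ⊤
  · simp [h]
  · obtain ⟨k, hk⟩ := WithTop.ne_top_iff_exists.1 h
    rw [← hk, WithTop.coe_le_coe]
    exact hm k ⟨y, hy, hk.symm⟩

/-- The distance of an integer to a nonempty set of integers. -/
lemma exists_distance (I : Set ℤ) (hI : I.OrdConnected) (hne : I.Nonempty) :
    ∃ δ : ℤ → ℤ, (∀ t, 0 ≤ δ t) ∧ (∀ t ∈ I, δ t = 0) ∧ (∀ t, δ t = 0 → t ∈ I) ∧
      ∀ k, δ k + δ k ≤ δ (k - 1) + δ (k + 1) := by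
  have h (t : ℤ) := Int.exists_least_of_bdd (P := fun k : ℤ => ∃ s ∈ I, |t - s| = k)
    ⟨0, by
      rintro k ⟨s, -, rfl⟩
      positivity⟩ (hne.elim fun s hs => ⟨_, s, hs, rfl⟩)
  choose δ hδ hmin using h
  have hmin' (t s : ℤ) (hs : s ∈ I) : δ t ≤ |t - s| := hmin t _ ⟨s, hs, rfl⟩
  have hnonneg (t) : 0 ≤ δ t := by
    obtain ⟨s, -, h⟩ := hδ t
    exact h ▸ abs_nonneg _
  refine ⟨δ, hnonneg, fun t ht => ?_, fun t ht => ?_, fun k => ?_⟩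
  · exact le_antisymm (by simpa using hmin' t t ht) (hnonneg t)
  · obtain ⟨s, hs, h⟩ := hδ t
    rw [ht, abs_eq_zero, sub_eq_zero] at h
    exact h ▸ hs
  · obtain ⟨s, hs, h₁⟩ := hδ (k - 1)
    obtain ⟨r, hr, h₂⟩ := hδ (k + 1)
    have hmid {q : ℤ} (hq : min s r ≤ q ∧ q ≤ max s r) : δ k ≤ |k - q| := by
      refine hmin' k q ?_
      obtain h | h := le_total s r
      · exact hI.out hs hr ⟨by omega, by omega⟩
      · exact hI.out hr hs ⟨by omega, by omega⟩
    -- The two roundings of the midpoint of the nearest points `s` and `r` lie in `I`, and their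
    -- distances to `k` add up to `|2 * k - s - r|`.
    have e1 := hmid (q := (s + r) / 2) (by omega)
    have e2 := hmid (q := (s + r + 1) / 2) (by omega)
    rw [Int.abs_eq_natAbs] at e1 e2
    rw [← h₁, ← h₂, Int.abs_eq_natAbs, Int.abs_eq_natAbs]
    omega

/-! ### Extended real values, weak duality and attainment -/

lemma toExtendedReal_coe (k : ℤ) : toExtendedReal (k : WithTop ℤ) = ((k : ℝ) : EReal) := rfl

lemma toExtendedReal_top : toExtendedReal ⊤ = ⊤ := rfl

lemma coe_le_toExtendedReal {m : ℤ} {a : WithTop ℤ} :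
    ((m : ℝ) : EReal) ≤ toExtendedReal a ↔ (m : WithTop ℤ) ≤ a := by
  cases a with
  | top => simp [toExtendedReal_top]
  | coe k => rw [toExtendedReal_coe, EReal.coe_le_coe_iff, Int.cast_le, WithTop.coe_le_coe]

lemma pairing_intVec {n : ℕ} (p x : Fin n → ℤ) :
    pairing p (intVec x) = ((∑ i, p i * x i : ℤ) : ℝ) := by
  simp [pairing, intVec]

lemma coe_le_mu {n : ℕ} {P : Set (Fin n → ℝ)} {p : Fin n → ℤ} {r : ℝ} :
    (r : EReal) ≤ mu P p ↔ ∀ y ∈ P, r ≤ pairing p y := by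
  simp [mu]

lemma mu_le {n : ℕ} {P : Set (Fin n → ℝ)} (p : Fin n → ℤ) {y : Fin n → ℝ} (hy : y ∈ P) :
    mu P p ≤ (pairing p y : EReal) :=
  iInf₂_le y hy

lemma le_integralConjugate {n : ℕ} (Φ : (Fin n → ℤ) → WithTop ℤ) (p : Fin n → ℤ)
    {x : Fin n → ℤ} {k : ℤ} (hx : Φ x = k) :
    ((pairing p (intVec x) - k : ℝ) : EReal) ≤ integralConjugate Φ p := by
  rw [EReal.coe_sub, ← toExtendedReal_coe, ← hx]
  exact le_iSup (fun x => (pairing p (intVec x) : EReal) - toExtendedReal (Φ x)) x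

lemma integralConjugate_le {n : ℕ} {Φ : (Fin n → ℤ) → WithTop ℤ} {p : Fin n → ℤ} {r : ℝ} :
    integralConjugate Φ p ≤ r ↔ ∀ x, ∀ k : ℤ, Φ x = k → pairing p (intVec x) - k ≤ r := by
  refine ⟨fun h x k hx => EReal.coe_le_coe_iff.1 ((le_integralConjugate Φ p hx).trans h),
    fun h => iSup_le fun x => ?_⟩
  by_cases hx : Φ x = ⊤
  · simp [hx, toExtendedReal_top]
  · obtain ⟨k, hk⟩ := WithTop.ne_top_iff_exists.1 hx
    rw [← hk, toExtendedReal_coe, ← EReal.coe_sub, EReal.coe_le_coe_iff]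
    exact h x k hk.symm

/-- Weak duality. -/
lemma mu_sub_integralConjugate_le {n : ℕ} {P : Set (Fin n → ℝ)} {Φ : (Fin n → ℤ) → WithTop ℤ}
    {x : Fin n → ℤ} (hx : x ∈ integerPoints P) (p : Fin n → ℤ) :
    mu P p - integralConjugate Φ p ≤ toExtendedReal (Φ x) := by
  by_cases hΦ : Φ x = ⊤
  · simp [hΦ, toExtendedReal_top]
  · obtain ⟨k, hk⟩ := WithTop.ne_top_iff_exists.1 hΦ
    refine (EReal.sub_le_sub (mu_le p hx) (le_integralConjugate Φ p hk.symm)).trans ?_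
    rw [← EReal.coe_sub, ← hk, toExtendedReal_coe, sub_sub_cancel]

lemma IsBoxInteger.le_pairing {n : ℕ} {P : Set (Fin n → ℝ)} (hP : IsBoxInteger P) {r : ℝ}
    {p : Fin n → ℤ} (h : ∀ x ∈ integerPoints P, r ≤ pairing p (intVec x)) {y : Fin n → ℝ}
    (hy : y ∈ P) : r ≤ pairing p y :=
  hP.sum_mul_nonneg _ y hy r (fun i => ⌊y i⌋) (fun i => ⌈y i⌉)
    ⟨fun i => Int.floor_le (y i), fun i => Int.le_ceil (y i)⟩ fun z hz _ => h z hz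

lemma IsBoxInteger.integerPoints_nonempty {n : ℕ} {P : Set (Fin n → ℝ)} (hP : IsBoxInteger P)
    (hne : P.Nonempty) : (integerPoints P).Nonempty := by
  by_contra h
  rw [not_nonempty_iff_eq_empty] at h
  -- Without integer points the bound `1 ≤ 0` would hold vacuously on them, hence on `P`.
  have := hP.le_pairing (r := 1) (p := 0) (by simp [h]) hne.some_mem
  norm_num [pairing] at this

/-- On integer points `⟨p, x⟩` takes integer values bounded below, so a least one exists; by
box-integrality it is a lower bound on all of `P`. -/
lemma IsBoxInteger.exists_mu_eq {n : ℕ} {P : Set (Fin n → ℝ)} (hP : IsBoxInteger P)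
    (hne : P.Nonempty) {p : Fin n → ℤ} (h : mu P p ≠ ⊥) :
    ∃ x ∈ P, mu P p = (pairing p x : EReal) := by
  have htop : mu P p ≠ ⊤ := ne_top_of_le_ne_top (EReal.coe_ne_top _) (mu_le p hne.some_mem)
  have hr := (EReal.coe_toReal htop h).le
  rw [coe_le_mu] at hr
  obtain ⟨z, hz⟩ := hP.integerPoints_nonempty hne
  obtain ⟨x, hx, m, hxm, hm⟩ := exists_minimizer (S := integerPoints P)
    (Φ := fun x => ((∑ i, p i * x i : ℤ) : WithTop ℤ)) ⟨z, hz, WithTop.coe_ne_top⟩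
    (B := ⌈(mu P p).toReal⌉) fun x hx => by
      rw [WithTop.coe_le_coe, Int.ceil_le, ← pairing_intVec]
      exact hr _ hx
  refine ⟨intVec x, hx, (mu_le p hx).antisymm (coe_le_mu.2 fun y hy => hP.le_pairing ?_ hy)⟩
  intro y hy
  have := hm y hy
  rw [← hxm, WithTop.coe_le_coe] at this
  rw [pairing_intVec, pairing_intVec]
  exact_mod_cast this

lemma exists_integralConjugate_eq {n : ℕ} {Φ : (Fin n → ℤ) → WithTop ℤ} (hdom : (effDom Φ).Nonempty)
    {p : Fin n → ℤ} (h : integralConjugate Φ p ≠ ⊤) :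
    ∃ x ∈ effDom Φ,
      integralConjugate Φ p = (pairing p (intVec x) : EReal) - toExtendedReal (Φ x) := by
  obtain ⟨z, hz⟩ := hdom
  obtain ⟨w, hw⟩ := WithTop.ne_top_iff_exists.1 hz
  have hbot : integralConjugate Φ p ≠ ⊥ :=
    ne_bot_of_le_ne_bot (EReal.coe_ne_bot _) (le_integralConjugate Φ p hw.symm)
  have hr := (EReal.coe_toReal h hbot).ge
  rw [integralConjugate_le] at hr
  obtain ⟨-, ⟨x, k, hx, rfl⟩, hmax⟩ := Int.exists_greatest_of_bdd
    (P := fun m : ℤ => ∃ x, ∃ k : ℤ, Φ x = k ∧ m = ∑ i, p i * x i - k)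
    ⟨⌊(integralConjugate Φ p).toReal⌋, by
      rintro _ ⟨x, k, hx, rfl⟩
      rw [Int.le_floor]
      push_cast [← pairing_intVec]
      simpa [pairing_intVec] using hr x k hx⟩ ⟨_, z, w, hw.symm, rfl⟩
  refine ⟨x, by simp [effDom, hx], ?_⟩
  rw [hx, toExtendedReal_coe, ← EReal.coe_sub]
  refine le_antisymm (integralConjugate_le.2 fun y j hy => ?_) (le_integralConjugate Φ p hx)
  rw [pairing_intVec, pairing_intVec]
  exact_mod_cast hmax _ ⟨y, j, hy, rfl⟩

/-! ### Strong duality, separation and primal feasibility -/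

/-- Strong duality at a minimizer. -/
lemma IsSeparableConvex.isGreatest {n : ℕ} {P : Set (Fin n → ℝ)}
    (hP : IsBoxInteger P) {Φ : (Fin n → ℤ) → WithTop ℤ} (hΦ : IsSeparableConvex Φ)
    {x : Fin n → ℤ} {m : ℤ} (hx : x ∈ integerPoints P) (hm : Φ x = m)
    (hmin : ∀ y ∈ integerPoints P, (m : WithTop ℤ) ≤ Φ y) :
    IsGreatest {v : EReal | ∃ p : Fin n → ℤ, v = mu P p - integralConjugate Φ p}
      ((m : ℝ) : EReal) := by
  have hub (p) : mu P p - integralConjugate Φ p ≤ ((m : ℝ) : EReal) := by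
    simpa [hm, toExtendedReal_coe] using mu_sub_integralConjugate_le (Φ := Φ) hx p
  obtain ⟨p, s, hp, hpΦ⟩ := hΦ.exists_integral_subgradient hP hx hm hmin
  refine ⟨⟨p, le_antisymm ?_ (hub p)⟩, by rintro _ ⟨p, rfl⟩; exact hub p⟩
  have hconj : integralConjugate Φ p ≤ ((s - m : ℝ) : EReal) := by
    rw [integralConjugate_le]
    intro z k hz
    have := hpΦ z
    rw [hz, WithTop.coe_le_coe] at this
    have : (m - s + ∑ i, p i * z i : ℝ) ≤ k := by exact_mod_cast this
    rw [pairing_intVec]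
    linarith
  refine le_trans (le_of_eq ?_) (EReal.sub_le_sub (coe_le_mu.2 hp) hconj)
  rw [← EReal.coe_sub, sub_sub_cancel]

lemma IsSeparableConvex.exists_isLeast_isGreatest {n : ℕ} {P : Set (Fin n → ℝ)}
    (hP : IsBoxInteger P) {Φ : (Fin n → ℤ) → WithTop ℤ} (hΦ : IsSeparableConvex Φ)
    (hne : ∃ x ∈ integerPoints P, Φ x ≠ ⊤) {r : ℝ}
    (hr : ∀ x ∈ integerPoints P, (r : EReal) ≤ toExtendedReal (Φ x)) :
    ∃ m : ℤ,
      IsLeast {v : EReal | ∃ x ∈ integerPoints P, v = toExtendedReal (Φ x)} ((m : ℝ) : EReal) ∧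
      IsGreatest {v : EReal | ∃ p : Fin n → ℤ, v = mu P p - integralConjugate Φ p}
        ((m : ℝ) : EReal) := by
  obtain ⟨x, hx, m, hm, hmin⟩ := exists_minimizer hne (B := ⌊r⌋) fun x hx =>
    coe_le_toExtendedReal.1 ((EReal.coe_le_coe_iff.2 (Int.floor_le r)).trans (hr x hx))
  refine ⟨m, ⟨⟨x, hx, by rw [hm, toExtendedReal_coe]⟩, ?_⟩, hΦ.isGreatest hP hx hm hmin⟩
  rintro _ ⟨y, hy, rfl⟩
  exact coe_le_toExtendedReal.2 (hmin y hy)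

/-- If `P` contains no integer point of the effective domain of `Φ`, then `P` and this domain are
strictly separated by an integral linear functional. -/
lemma IsSeparableConvex.exists_separation {n : ℕ} {P : Set (Fin n → ℝ)}
    (hP : IsBoxInteger P) (hPne : P.Nonempty) {Φ : (Fin n → ℤ) → WithTop ℤ}
    (hΦ : IsSeparableConvex Φ) (hdom : (effDom Φ).Nonempty)
    (hdisj : ∀ x ∈ integerPoints P, Φ x = ⊤) :
    ∃ (q : Fin n → ℤ) (s : ℝ), (∀ y ∈ P, s + 1 ≤ pairing q y) ∧
      ∀ z ∈ effDom Φ, pairing q (intVec z) ≤ s := by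
  obtain ⟨φ, hφ, hΦφ⟩ := hΦ
  have hmem (x) : x ∈ effDom Φ ↔ ∀ i, x i ∈ effDom (φ i) := by
    simp [effDom, hΦφ, WithTop.sum_eq_top]
  obtain ⟨z₀, hz₀⟩ := hdom
  choose δ hδ0 hδ1 hδ2 hδ3 using fun i =>
    exists_distance (effDom (φ i)) (hφ i).1 ⟨z₀ i, (hmem _).1 hz₀ i⟩
  -- The `ℓ₁`-distance to the domain of `Φ`, which is a product of intervals. Its minimum over the
  -- integer points of `P` is a positive integer, and this gives the gap of `1`.
  set Ψ : (Fin n → ℤ) → WithTop ℤ := fun x => ((∑ i, δ i (x i) : ℤ) : WithTop ℤ) with hΨ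
  have hΨsep : IsSeparableConvex Ψ := by
    refine ⟨fun i t => (δ i t : WithTop ℤ), fun i => ⟨?_, fun k => ?_⟩, fun x => ?_⟩
    · have : effDom (fun t => (δ i t : WithTop ℤ)) = univ := by ext; simp [effDom]
      rw [this]
      exact ordConnected_univ
    · exact WithTop.coe_le_coe.2 (hδ3 i k)
    · exact WithTop.coe_sum _ _
  obtain ⟨y₀, hy₀⟩ := hP.integerPoints_nonempty hPne
  obtain ⟨x, hx, m, hm, hmin⟩ := exists_minimizer (S := integerPoints P) (Φ := Ψ)
    ⟨y₀, hy₀, WithTop.coe_ne_top⟩ (B := 0) fun x _ =>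
      WithTop.coe_le_coe.2 (Finset.sum_nonneg fun i _ => hδ0 i (x i))
  have hm' : ∑ i, δ i (x i) = m := WithTop.coe_injective hm
  have hm1 : 1 ≤ m := by
    by_contra! hlt
    have h0 : ∑ i, δ i (x i) = 0 :=
      le_antisymm (by omega) (Finset.sum_nonneg fun i _ => hδ0 i (x i))
    rw [Finset.sum_eq_zero_iff_of_nonneg fun i _ => hδ0 i (x i)] at h0
    exact (hmem x).2 (fun i => hδ2 i _ (h0 i (Finset.mem_univ i))) (hdisj x hx)
  obtain ⟨q, s, hq, hqΨ⟩ := hΨsep.exists_integral_subgradient hP hx hm hmin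
  have hm1' : (1 : ℝ) ≤ m := by exact_mod_cast hm1
  refine ⟨q, s - m, fun y hy => by linarith [hq y hy], fun z hz => ?_⟩
  have h := WithTop.coe_le_coe.1 (hqΨ z)
  rw [Finset.sum_eq_zero fun i _ => hδ1 i _ ((hmem z).1 hz i)] at h
  have : (m - s + (∑ i, q i * z i : ℤ) : ℝ) ≤ 0 := by exact_mod_cast h
  rw [pairing_intVec]
  linarith

lemma pairing_add_nsmul {n : ℕ} (p q : Fin n → ℤ) (k : ℕ) (y : Fin n → ℝ) :
    pairing (p + k • q) y = pairing p y + k * pairing q y := by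
  simp [pairing, add_mul, Finset.sum_add_distrib, Finset.mul_sum, mul_assoc]

/-- If the dual problem is bounded and has a feasible solution, then the primal problem has a
feasible solution. -/
lemma IsSeparableConvex.exists_ne_top {n : ℕ} {P : Set (Fin n → ℝ)}
    (hP : IsBoxInteger P) (hPne : P.Nonempty) {Φ : (Fin n → ℤ) → WithTop ℤ}
    (hΦ : IsSeparableConvex Φ) (hdom : (effDom Φ).Nonempty) {p : Fin n → ℤ} {α β M : ℝ}
    (hα : (α : EReal) ≤ mu P p) (hβ : integralConjugate Φ p ≤ β)
    (hM : ∀ p, mu P p - integralConjugate Φ p ≤ M) :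
    ∃ x ∈ integerPoints P, Φ x ≠ ⊤ := by
  by_contra! hdisj
  obtain ⟨q, s, hq, hqΦ⟩ := hΦ.exists_separation hP hPne hdom hdisj
  rw [coe_le_mu] at hα
  rw [integralConjugate_le] at hβ
  -- Moving from `p` to `p + k • q` raises the lower bound `α - β` on the dual value by at least
  -- `k`.
  obtain ⟨k, hk⟩ := exists_nat_gt (M - (α - β))
  have h1 : ((α + k * (s + 1) : ℝ) : EReal) ≤ mu P (p + k • q) := coe_le_mu.2 fun y hy => by
    rw [pairing_add_nsmul]
    exact add_le_add (hα y hy) (mul_le_mul_of_nonneg_left (hq y hy) k.cast_nonneg)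
  have h2 : integralConjugate Φ (p + k • q) ≤ ((β + k * s : ℝ) : EReal) :=
    integralConjugate_le.2 fun z j hz => by
      rw [pairing_add_nsmul]
      have := mul_le_mul_of_nonneg_left (hqΦ z (by simp [effDom, hz])) (k.cast_nonneg (α := ℝ))
      linarith [hβ z j hz]
  have h3 := (EReal.sub_le_sub h1 h2).trans (hM _)
  rw [← EReal.coe_sub, EReal.coe_le_coe_iff] at h3
  linarith

theorem mainTheorem4 {n : ℕ} (P : Set (Fin n → ℝ)) (hP : IsBoxInteger P) (hPne : P.Nonempty)
    (Φ : (Fin n → ℤ) → WithTop ℤ) (hΦ : IsSeparableConvex Φ) (hdom : (effDom Φ).Nonempty) :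
    -- the minimum defining `μ(p)` and the maximum defining `Φ•(p)` are attained where finite
    (∀ p : Fin n → ℤ, IsFiniteValue (mu P p) → ∃ x ∈ P, mu P p = ((pairing p x : ℝ) : EReal)) ∧
    (∀ p : Fin n → ℤ, IsFiniteValue (integralConjugate Φ p) → ∃ x ∈ effDom Φ,
      integralConjugate Φ p = ((pairing p (intVec x) : ℝ) : EReal) - toExtendedReal (Φ x)) ∧
    -- the min-max formula, when one of its two sides is finite
    (IsFiniteValue (⨅ x ∈ integerPoints P, toExtendedReal (Φ x)) ∨
        IsFiniteValue (⨆ p : Fin n → ℤ, mu P p - integralConjugate Φ p) →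
      ∃ m : ℤ,
        IsLeast {v : EReal | ∃ x ∈ integerPoints P, v = toExtendedReal (Φ x)} ((m : ℝ) : EReal) ∧
        IsGreatest {v : EReal | ∃ p : Fin n → ℤ, v = mu P p - integralConjugate Φ p}
          ((m : ℝ) : EReal)) := by

  refine ⟨fun p hp => hP.exists_mu_eq hPne hp.1,
    fun p hp => exists_integralConjugate_eq hdom hp.2, ?_⟩
  rintro (⟨hbot, htop⟩ | ⟨hbot, htop⟩)
  · refine hΦ.exists_isLeast_isGreatest hP ?_
      (r := (⨅ x ∈ integerPoints P, toExtendedReal (Φ x)).toReal) fun x hx => ?_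
    · by_contra! h
      exact htop (iInf₂_eq_top.2 fun x hx => by rw [h x hx, toExtendedReal_top])
    · rw [EReal.coe_toReal htop hbot]
      exact iInf₂_le x hx
  -- A dual value other than `⊥` gives a `p` with `mu` and conjugate both finite. It serves as
  -- starting point for primal feasibility and, by weak duality, bounds the primal below.
  · obtain ⟨p, hp⟩ : ∃ p : Fin n → ℤ, mu P p - integralConjugate Φ p ≠ ⊥ := by
      by_contra! h
      exact hbot (iSup_eq_bot.2 h)
    have hμ : mu P p ≠ ⊥ := fun h => hp (by rw [h, EReal.bot_sub])
    have hc : integralConjugate Φ p ≠ ⊤ := fun h => hp (by rw [h, EReal.sub_top])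
    obtain ⟨y, -, hy⟩ := hP.exists_mu_eq hPne hμ
    obtain ⟨z, hz, hpz⟩ := exists_integralConjugate_eq hdom hc
    obtain ⟨k, hk⟩ := WithTop.ne_top_iff_exists.1 hz
    rw [← hk, toExtendedReal_coe, ← EReal.coe_sub] at hpz
    refine hΦ.exists_isLeast_isGreatest hP
      (hΦ.exists_ne_top hP hPne hdom hy.ge hpz.le
        (M := (⨆ p : Fin n → ℤ, mu P p - integralConjugate Φ p).toReal) fun p => ?_)
      (r := pairing p y - (pairing p (intVec z) - k)) fun x hx => ?_
    · rw [EReal.coe_toReal htop hbot]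
      exact le_iSup (fun p => mu P p - integralConjugate Φ p) p
    · rw [EReal.coe_sub, ← hy, ← hpz]
      exact mu_sub_integralConjugate_le hx p
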